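/- Let $n \ge 2$ and $d \ge 8$, and let $\mathbf{Z}_n^d$ be the discrete torus: the graph on $(\mathbf{Z}/n\mathbf{Z})^d$ in which two distinct vertices are adjacent when they differ by $\pm 1$ in exactly one coordinate and agree in all other coordinates (the hypercube if $n = 2$). Let $P$ be the transition matrix of lazy random walk on it: $P(x,x) = \tfrac12$, $P(x,y) = \tfrac{1}{2\deg(x)}$ if $x,y$ are adjacent, and $P(x,y)=0$ otherwise. Let $\pi$ be its stationary distribution, let $$t_{\rm u} = \min\Big\{ t \ge 0 : \max_{x,y} \Big| \frac{P^t(x,y) - \pi(y)}{\pi(y)} \Big| \le \frac{1}{2e} \Big\}$$ be the uniform mixing time, and let $$G(x,y) = \sum_{t=0}^{t_{\rm u}} P^t(x,y)$$ be the Green's function, i.e. the expected number of visits to $y$ at the times $0,1,\dots,t_{\rm u}$ by the walk started at $x$. Let $|x-y|$ denote the $L^1$ distance on $\mathbf{Z}_n^d$, i.e. the sum over the coordinates of the distance in the cycle $\mathbf{Z}_n$. For every integer $k \ge 0$ there is a constant $C_k > 0$, depending only on $k$ (not on $n$ or $d$), such that for all $n \ge 2$ and all $d \ge 8$ with $k \le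 d/8$, $$G(x,y) \le \frac{C_k}{d^k} \quad \text{for all } x,y \in \mathbf{Z}_n^d \text{ with } |x-y| \ge k.$$ -/

import Mathlib

set_option linter.unusedSectionVars false

namespace LazyWalk

open Finset

section General

variable {V : Type*} [Fintype V] [DecidableEq V] (G : SimpleGraph V) [DecidableRel G.Adj]

/-- The transition matrix of lazy random walk on a finite graph: stay put with probability `1/2`,
otherwise move to a uniformly chosen neighbour. -/
noncomputable def transition : Matrix V V ℝ := fun x y =>
  if x = y then 1 / 2 else if G.Adj x y then 1 / (2 * (G.degree x : ℝ)) else 0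

/-- The stationary distribution of lazy random walk, proportional to the degree. -/
noncomputable def stationary (x : V) : ℝ := (G.degree x : ℝ) / ∑ z, (G.degree z : ℝ)

/-- At time `t`, every transition probability is within relative distance `ε` of the stationary
distribution. -/
def UniformlyMixed (ε : ℝ) (t : ℕ) : Prop :=
  ∀ x y : V, |((transition G ^ t) x y - stationary G y) / stationary G y| ≤ ε

/-- The `ε`-uniform mixing time: the least `t` at which the chain is uniformly mixed. That such a
`t` exists on connected graphs with at least two vertices is `exists_uniformlyMixed` below. -/
noncomputable def uniformMixingTime (ε : ℝ) : ℕ := sInf {t : ℕ | UniformlyMixed G ε t}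

/-- The uniform mixing time at the default level `1 / (2e)`. -/
noncomputable def tUnif : ℕ := uniformMixingTime G (2 * Real.exp 1)⁻¹

/-- The Green's function: the expected number of visits to `y` in the times `0, 1, …, tUnif`
of the lazy random walk started at `x`. -/
noncomputable def green (x y : V) : ℝ := ∑ t ∈ Finset.range (tUnif G + 1), (transition G ^ t) x y

/-! Sanity facts: the transition matrix is stochastic, `stationary` is a stationary probability
distribution, and the set in the definition of the uniform mixing time is nonempty. -/

theorem transition_nonneg (x y : V) : 0 ≤ transition G x y := by
  unfold transition; split_ifs <;> positivity

theorem transition_row_sum (h : ∀ x, 0 < G.degree x) (x : V) : ∑ y, transition G x y = 1 := by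
  have h1 : ∀ y, transition G x y =
      (if x = y then (1 / 2 : ℝ) else 0) +
        (if G.Adj x y then 1 / (2 * (G.degree x : ℝ)) else 0) := by
    intro y
    unfold transition
    by_cases hxy : x = y
    · subst hxy; simp
    · simp [hxy]
  have h2 : (0 : ℝ) < G.degree x := by exact_mod_cast h x
  simp_rw [h1, Finset.sum_add_distrib]
  rw [← Finset.sum_filter (fun y => G.Adj x y), Finset.sum_const, ← G.neighborFinset_eq_filter,
    G.card_neighborFinset_eq_degree, Finset.sum_ite_eq]
  simp only [mem_univ, if_true, nsmul_eq_mul]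
  field_simp
  norm_num

theorem degree_mul_transition (h : ∀ x, 0 < G.degree x) (x y : V) :
    (G.degree x : ℝ) * transition G x y = G.degree y * transition G y x := by
  have hx : (0 : ℝ) < G.degree x := by exact_mod_cast h x
  have hy : (0 : ℝ) < G.degree y := by exact_mod_cast h y
  unfold transition
  by_cases hxy : x = y
  · subst hxy; simp
  · by_cases ha : G.Adj x y
    · simp only [hxy, Ne.symm hxy, ha, ha.symm, if_true, if_false]
      field_simp
    · have hb : ¬ G.Adj y x := fun hb => ha hb.symm
      simp [hxy, Ne.symm hxy, ha, hb]

theorem stationary_pos (h : ∀ x, 0 < G.degree x) (x : V) : 0 < stationary G x := by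
  exact div_pos (Nat.cast_pos.2 (h x))
    (Finset.sum_pos (fun z _ => Nat.cast_pos.2 (h z)) ⟨x, mem_univ x⟩)

theorem stationary_sum [Nonempty V] (h : ∀ x, 0 < G.degree x) : ∑ x, stationary G x = 1 := by
  have : (0 : ℝ) < ∑ z, (G.degree z : ℝ) :=
    Finset.sum_pos (fun z _ => by exact_mod_cast h z) Finset.univ_nonempty
  unfold stationary
  rw [← Finset.sum_div]
  exact div_self this.ne'

theorem stationary_invariant (h : ∀ x, 0 < G.degree x) (y : V) :
    ∑ x, stationary G x * transition G x y = stationary G y := by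
  have h1 : ∀ x, stationary G x * transition G x y = stationary G y * transition G y x := by
    intro x
    unfold stationary
    rw [div_mul_eq_mul_div, div_mul_eq_mul_div, degree_mul_transition G h]
  simp_rw [h1, ← Finset.mul_sum, transition_row_sum G h, mul_one]

theorem pow_nonneg' (t : ℕ) (x y : V) : 0 ≤ (transition G ^ t) x y := by
  induction t generalizing x y with
  | zero => rw [pow_zero, Matrix.one_apply]; split_ifs <;> norm_num
  | succ t ih =>
    rw [pow_succ, Matrix.mul_apply]
    exact Finset.sum_nonneg fun z _ => mul_nonneg (ih x z) (transition_nonneg G z y)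

theorem pow_row_sum (h : ∀ x, 0 < G.degree x) (t : ℕ) (x : V) :
    ∑ y, (transition G ^ t) x y = 1 := by
  induction t with
  | zero => simp [Matrix.one_apply]
  | succ t ih =>
    simp_rw [pow_succ, Matrix.mul_apply]
    rw [Finset.sum_comm]
    simp_rw [← Finset.mul_sum, transition_row_sum G h, mul_one, ih]

theorem pow_invariant (h : ∀ x, 0 < G.degree x) (t : ℕ) (y : V) :
    ∑ x, stationary G x * (transition G ^ t) x y = stationary G y := by
  induction t generalizing y with
  | zero => simp [Matrix.one_apply]
  | succ t ih =>
    simp_rw [pow_succ, Matrix.mul_apply, Finset.mul_sum]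
    rw [Finset.sum_comm]
    simp_rw [← mul_assoc, ← Finset.sum_mul, ih]
    exact stationary_invariant G h y

theorem pow_add_one_pos (t : ℕ) {x y z : V} (h1 : 0 < (transition G ^ t) x y)
    (h2 : 0 < transition G y z) : 0 < (transition G ^ (t + 1)) x z := by
  rw [pow_succ, Matrix.mul_apply]
  exact lt_of_lt_of_le (mul_pos h1 h2) (Finset.single_le_sum
    (f := fun w => (transition G ^ t) x w * transition G w z)
    (fun w _ => mul_nonneg (pow_nonneg' G t x w) (transition_nonneg G w z)) (mem_univ y))

theorem exists_pow_pos (hc : G.Connected) (hd : ∀ x, 0 < G.degree x) :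
    ∃ T : ℕ, ∀ x y, 0 < (transition G ^ T) x y := by
  have hstay : ∀ x, 0 < transition G x x := fun x => by simp [transition]
  have hadj : ∀ x y, G.Adj x y → 0 < transition G x y := by
    intro x y h
    have : (0 : ℝ) < G.degree x := by exact_mod_cast hd x
    simp only [transition, h.ne, h, if_true, if_false]
    positivity
  have hmono : ∀ x y s t, s ≤ t → 0 < (transition G ^ s) x y → 0 < (transition G ^ t) x y := by
    intro x y s t hst h
    induction t, hst using Nat.le_induction with
    | base => exact h
    | succ t _ ih => exact pow_add_one_pos G t ih (hstay y)
  have hex : ∀ x y, ∃ t, 0 < (transition G ^ t) x y := by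
    intro x y
    have hr : Relation.ReflTransGen G.Adj x y :=
      (G.reachable_iff_reflTransGen x y).1 (hc.preconnected x y)
    induction hr with
    | refl => exact ⟨0, by simp⟩
    | tail _ hbc ih =>
      obtain ⟨t, ht⟩ := ih
      exact ⟨t + 1, pow_add_one_pos G t ht (hadj _ _ hbc)⟩
  choose f hf using hex
  refine ⟨∑ x, ∑ y, f x y, fun x y => hmono x y (f x y) _ ?_ (hf x y)⟩
  exact (Finset.single_le_sum (f := fun y => f x y) (fun _ _ => Nat.zero_le _) (mem_univ y)).trans
    (Finset.single_le_sum (f := fun x => ∑ y, f x y) (fun _ _ => Nat.zero_le _) (mem_univ x))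

theorem exists_uniformlyMixed [Nontrivial V] (hc : G.Connected) {ε : ℝ} (hε : 0 < ε) :
    ∃ t, UniformlyMixed G ε t := by
  have hd : ∀ x, 0 < G.degree x := fun x => hc.preconnected.degree_pos_of_nontrivial x
  have hπ := stationary_pos G hd
  obtain ⟨T, hT⟩ := exists_pow_pos G hc hd
  -- minorisation of the `T`-step matrix by the stationary distribution
  obtain ⟨δ, hδ0, hδ1, hδ⟩ : ∃ δ : ℝ, 0 < δ ∧ δ ≤ 1 ∧
      ∀ x y, δ * stationary G y ≤ (transition G ^ T) x y := by
    obtain ⟨p, -, hp⟩ := Finset.exists_min_image (univ : Finset (V × V))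
      (fun p => (transition G ^ T) p.1 p.2) univ_nonempty
    refine ⟨min ((transition G ^ T) p.1 p.2) 1, lt_min (hT _ _) one_pos, min_le_right _ _, ?_⟩
    intro x y
    have h1 : stationary G y ≤ 1 := by
      rw [← stationary_sum G hd]
      exact Finset.single_le_sum (f := stationary G) (fun z _ => (hπ z).le) (mem_univ y)
    calc min ((transition G ^ T) p.1 p.2) 1 * stationary G y
        ≤ (transition G ^ T) p.1 p.2 * 1 :=
          mul_le_mul (min_le_left _ _) h1 (hπ y).le (hT _ _).le
      _ ≤ _ := by rw [mul_one]; exact hp (x, y) (mem_univ _)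
  have hbound : ∀ m : ℕ, ∀ x y,
      |(transition G ^ (T * m)) x y - stationary G y| ≤ (1 - δ) ^ m * 1 := by
    intro m
    induction m with
    | zero =>
      intro x y
      have h1 : stationary G y ≤ 1 := by
        rw [← stationary_sum G hd]
        exact Finset.single_le_sum (f := stationary G) (fun z _ => (hπ z).le) (mem_univ y)
      have h2 := hπ y
      rw [mul_zero, pow_zero, Matrix.one_apply, abs_le]
      split_ifs <;> constructor <;> linarith
    | succ m ih =>
      intro x y
      have key : (transition G ^ (T * (m + 1))) x y - stationary G y =
          ∑ z, ((transition G ^ T) x z - δ * stationary G z) *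
            ((transition G ^ (T * m)) z y - stationary G y) := by
        have e1 : (transition G ^ (T * (m + 1))) x y =
            ∑ z, (transition G ^ T) x z * (transition G ^ (T * m)) z y := by
          rw [← Matrix.mul_apply, ← pow_add, Nat.mul_succ, Nat.add_comm]
        have e2 := pow_row_sum G hd T x
        have e3 := pow_invariant G hd (T * m) y
        have e4 := stationary_sum G hd
        have e5 : ∀ z, ((transition G ^ T) x z - δ * stationary G z) *
            ((transition G ^ (T * m)) z y - stationary G y) =
            (transition G ^ T) x z * (transition G ^ (T * m)) z y
              - (transition G ^ T) x z * stationary G y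
              - δ * (stationary G z * (transition G ^ (T * m)) z y)
              + δ * (stationary G z * stationary G y) := fun z => by ring
        simp_rw [e5, Finset.sum_add_distrib, Finset.sum_sub_distrib, ← Finset.mul_sum,
          ← Finset.sum_mul, e2, e3, e4, e1]
        ring
      rw [key]
      calc _ ≤ ∑ z, |((transition G ^ T) x z - δ * stationary G z) *
            ((transition G ^ (T * m)) z y - stationary G y)| := Finset.abs_sum_le_sum_abs _ _
        _ ≤ ∑ z, ((transition G ^ T) x z - δ * stationary G z) * ((1 - δ) ^ m * 1) := by
          refine Finset.sum_le_sum fun z _ => ?_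
          rw [abs_mul, abs_of_nonneg (sub_nonneg.2 (hδ x z))]
          exact mul_le_mul_of_nonneg_left (ih z y) (sub_nonneg.2 (hδ x z))
        _ = (1 - δ) ^ (m + 1) * 1 := by
          rw [← Finset.sum_mul, Finset.sum_sub_distrib, ← Finset.mul_sum, pow_row_sum G hd,
            stationary_sum G hd]
          ring
  obtain ⟨y₀, -, hy₀⟩ := Finset.exists_min_image (univ : Finset V) (stationary G) univ_nonempty
  obtain ⟨m, hm⟩ := exists_pow_lt_of_lt_one (mul_pos hε (hπ y₀)) (by linarith : 1 - δ < 1)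
  refine ⟨T * m, fun x y => ?_⟩
  rw [abs_div, abs_of_pos (hπ y), div_le_iff₀ (hπ y)]
  calc _ ≤ (1 - δ) ^ m * 1 := hbound m x y
    _ ≤ ε * stationary G y₀ := by rw [mul_one]; exact hm.le
    _ ≤ _ := mul_le_mul_of_nonneg_left (hy₀ y (mem_univ y)) hε.le

end General

/-- The torus `ℤ_n^d`: two distinct vertices are adjacent if they differ by `±1` in one coordinate
and agree in all others. For `n = 2` this is the hypercube. -/
def torus (n d : ℕ) : SimpleGraph (Fin d → ZMod n) where
  Adj x y := x ≠ y ∧ ∃ i, (y i = x i + 1 ∨ x i = y i + 1) ∧ ∀ j, j ≠ i → x j = y j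
  symm := ⟨fun _ _ ⟨h, i, hi, hj⟩ => ⟨h.symm, i, hi.symm, fun j hji => (hj j hji).symm⟩⟩
  loopless := ⟨fun _ h => h.1 rfl⟩

instance (n d : ℕ) : DecidableRel (torus n d).Adj := fun x y =>
  inferInstanceAs (Decidable (x ≠ y ∧ ∃ i, (y i = x i + 1 ∨ x i = y i + 1) ∧
    ∀ j, j ≠ i → x j = y j))

/-- The `L¹` distance on `ℤ_n^d`: the sum over the coordinates of the distance in the cycle `ℤ_n`,
`valMinAbs` being the representative of a residue that is closest to `0`. -/
def l1dist {n d : ℕ} (x y : Fin d → ZMod n) : ℕ := ∑ i, (x i - y i).valMinAbs.natAbs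

theorem torus_connected {n : ℕ} (hn : 2 ≤ n) (d : ℕ) : (torus n d).Connected := by
  have : Fact (1 < n) := ⟨hn⟩
  have : NeZero n := ⟨by omega⟩
  have hstep : ∀ (x : Fin d → ZMod n) (i : Fin d), (torus n d).Adj x (x + Pi.single i 1) := by
    intro x i
    refine ⟨?_, i, Or.inl (by simp), fun j hj => by simp [hj]⟩
    intro h
    have := congrFun h i
    simp at this
  have hmulti : ∀ (x : Fin d → ZMod n) (i : Fin d) (a : ZMod n),
      (torus n d).Reachable x (x + Pi.single i a) := by
    intro x i a
    have : ∀ k : ℕ, (torus n d).Reachable x (x + Pi.single i (k : ZMod n)) := by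
      intro k
      induction k with
      | zero => simp
      | succ k ih =>
        rw [Nat.cast_succ, Pi.single_add, ← add_assoc]
        exact ih.trans (hstep _ i).reachable
    simpa using this a.val
  have hzero : ∀ x : Fin d → ZMod n, (torus n d).Reachable 0 x := by
    intro x
    have : ∀ s : Finset (Fin d), (torus n d).Reachable 0 (∑ i ∈ s, Pi.single i (x i)) := by
      intro s
      induction s using Finset.induction_on with
      | empty => simp
      | insert i s hi ih =>
        rw [Finset.sum_insert hi, add_comm]
        exact ih.trans (hmulti _ i _)
    simpa [Finset.univ_sum_single] using this univ
  exact ⟨fun x y => (hzero x).symm.trans (hzero y)⟩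

/-- The uniform mixing time of the torus is attained. -/
theorem torus_uniformlyMixed_tUnif {n d : ℕ} [NeZero n] (hn : 2 ≤ n) (hd : 0 < d) :
    UniformlyMixed (torus n d) (2 * Real.exp 1)⁻¹ (tUnif (torus n d)) := by
  have : Fact (1 < n) := ⟨hn⟩
  have : Nonempty (Fin d) := ⟨⟨0, hd⟩⟩
  exact Nat.sInf_mem (s := {t | UniformlyMixed (torus n d) (2 * Real.exp 1)⁻¹ t})
    (exists_uniformlyMixed (torus n d) (torus_connected hn d) (by positivity))

end LazyWalk

/-! The sum defining the Green's function is split at time `d`.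

For `t ≤ d` the walk is compared with the continuous-time walk at time `t`, that is, the lazy walk
run for a Poisson number of steps. A Poisson variable of mean `t` equals `t` with probability at
least `1 / (e (t + 1))`, so this comparison costs only that factor (`pow_transition_torus_le_prod`).
In continuous time the coordinates are independent and each runs for time `u = t / d ≤ 1`. A
coordinate that must move a distance `j` contributes at most `u ^ j`; one that is only required to
be at its target contributes at most the return probability of the cycle, which is at most `exp (-u
/ 4)`. At distance at least `k` this gives `(t / d) ^ k` from at most `k` coordinates and a factor
exponentially small in `t` from the others (`prod_heatKernel_le`). Since `(t + 1) t ^ k exp (-7 t /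
32)` is summable, these times contribute `O(d ^ (-k))`.

For `t > d` distance is ignored. A transition probability is at most the `d`-th power of the return
probability of the cycle at time `t / d`. All but eight of the factors are bounded by `3 / 4`; the
last eight give `(d / t) ^ 2 + n ^ (-8)` up to a constant. Summing over `t` up to the crude bound `3
n ^ 3 d ^ 2` for the mixing time leaves `O(d ^ 2 (3 / 4) ^ d)`, which is below every power of `d`.
-/

namespace LazyWalk
open Finset

/-! ### One-step transition probabilities of the torus. -/

section Transition

variable {n : ℕ} [NeZero n] {d : ℕ}

/-- The number of signed unit steps leading from `x` to `y`. -/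
def stepCount (x y : Fin d → ZMod n) : ℕ :=
  ∑ i, ((if y = x + Pi.single i 1 then 1 else 0) + (if y = x - Pi.single i 1 then 1 else 0))

/-- For `n = 2` the steps `+1` and `-1` coincide and each neighbour is counted twice. Counting steps
rather than neighbours gives one formula for the hypercube and for `n ≥ 3`. -/
theorem stepCount_eq (hn : 2 ≤ n) (x y : Fin d → ZMod n) :
    stepCount x y = (if n = 2 then 2 else 1) * (if (torus n d).Adj x y then 1 else 0) := by
  have : Fact (1 < n) := ⟨hn⟩
  have key : ∀ i, (y = x + Pi.single i 1 ∨ y = x - Pi.single i 1) ↔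
      ((y i = x i + 1 ∨ x i = y i + 1) ∧ ∀ j, j ≠ i → x j = y j) := by
    intro i
    constructor
    · rintro (rfl | rfl)
      · exact ⟨Or.inl (by simp), fun j hj => by simp [hj]⟩
      · exact ⟨Or.inr (by simp), fun j hj => by simp [hj]⟩
    · rintro ⟨h | h, hj⟩
      · left
        ext j
        by_cases hji : j = i
        · subst hji; simp [h]
        · simp [hji, hj j hji]
      · right
        ext j
        by_cases hji : j = i
        · subst hji; simp [h]
        · simp [hji, hj j hji]
  by_cases ha : (torus n d).Adj x y
  · obtain ⟨-, i, h1, h2⟩ := id ha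
    have hi := (key i).2 ⟨h1, h2⟩
    have hne : y i ≠ x i := by
      rcases h1 with h | h <;> intro h' <;> rw [h'] at h <;> simp at h
    have hz : ∀ j, j ≠ i → ¬ (y = x + Pi.single j 1 ∨ y = x - Pi.single j 1) := fun j hj h =>
      hne (((key j).1 h).2 i (Ne.symm hj)).symm
    unfold stepCount
    rw [Finset.sum_eq_single i, if_pos ha]
    · by_cases h2n : n = 2
      · subst h2n
        have : (Pi.single i 1 : Fin d → ZMod 2) = - Pi.single i 1 := by
          rw [← Pi.single_neg]; rfl
        have h3 : x + Pi.single i 1 = x - Pi.single i 1 := by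
          rw [sub_eq_add_neg, ← this]
        rw [← h3] at hi ⊢
        simp [hi.elim id id]
      · have h3 : x + Pi.single i 1 ≠ x - Pi.single i 1 := by
          intro h
          have h4 := congrFun h i
          simp only [Pi.add_apply, Pi.single_eq_same, Pi.sub_apply] at h4
          have h5 : ((2 : ℕ) : ZMod n) = 0 := by
            push_cast
            linear_combination h4
          rw [ZMod.natCast_eq_zero_iff] at h5
          exact h2n (le_antisymm (Nat.le_of_dvd two_pos h5) hn)
        rcases hi with h | h
        · rw [if_pos h, if_neg (by rw [h]; exact h3), if_neg h2n]
        · rw [if_neg (by rw [h]; exact h3.symm), if_pos h, if_neg h2n]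
    · intro j _ hj
      have := hz j hj
      push Not at this
      simp [this]
    · simp
  · rw [if_neg ha, mul_zero]
    refine Finset.sum_eq_zero fun i _ => ?_
    have : ¬ (y = x + Pi.single i 1 ∨ y = x - Pi.single i 1) := by
      intro h
      refine ha ⟨?_, i, (key i).1 h⟩
      rintro rfl
      rcases h with h | h <;> simpa using congrFun h.symm i
    push Not at this
    simp [this]

theorem sum_stepCount_mul {R : Type*} [CommSemiring R] (x : Fin d → ZMod n)
    (f : (Fin d → ZMod n) → R) :
    ∑ y, (stepCount x y : R) * f y =
      ∑ i, (f (x + Pi.single i 1) + f (x - Pi.single i 1)) := by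
  simp only [stepCount, Nat.cast_sum, Finset.sum_mul]
  rw [Finset.sum_comm]
  refine Finset.sum_congr rfl fun i _ => ?_
  simp [add_mul, Finset.sum_add_distrib]

theorem degree_torus (hn : 2 ≤ n) (x : Fin d → ZMod n) :
    (if n = 2 then 2 else 1) * (torus n d).degree x = 2 * d := by
  have h := sum_stepCount_mul (R := ℕ) x (fun _ => 1)
  simp only [stepCount_eq hn, mul_one, sum_const, card_univ, Fintype.card_fin, Nat.cast_id] at h
  rw [← Finset.mul_sum, Finset.sum_boole, ← (torus n d).neighborFinset_eq_filter,
    (torus n d).card_neighborFinset_eq_degree] at h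
  rw [Nat.cast_id] at h
  rw [h, smul_eq_mul, mul_comm]

theorem transition_torus (hn : 2 ≤ n) (hd : 0 < d) (x y : Fin d → ZMod n) :
    transition (torus n d) x y =
      (if x = y then 1 / 2 else 0) + (stepCount x y : ℝ) / (4 * d) := by
  have hdeg := degree_torus hn x
  have hm : (0 : ℝ) < ((if n = 2 then 2 else 1 : ℕ) : ℝ) := by split_ifs <;> norm_num
  rw [stepCount_eq hn]
  set m : ℕ := if n = 2 then 2 else 1
  have hdeg' : (m : ℝ) * ((torus n d).degree x : ℝ) = 2 * d := by exact_mod_cast hdeg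
  have hd' : (0 : ℝ) < d := by exact_mod_cast hd
  unfold transition
  by_cases hxy : x = y
  · subst hxy; simp
  · by_cases ha : (torus n d).Adj x y
    · have h4 : (4 * d : ℝ) = m * (2 * ((torus n d).degree x : ℝ)) := by linarith
      simp only [hxy, ha, if_true, if_false, h4]
      rw [mul_one, zero_add, ← div_div (m : ℝ), div_self hm.ne']
    · simp [hxy, ha]

theorem stationary_torus (hn : 2 ≤ n) (hd : 0 < d) (x : Fin d → ZMod n) :
    stationary (torus n d) x = ((n : ℝ) ^ d)⁻¹ := by
  have hdeg : ∀ z, (torus n d).degree z = (torus n d).degree x := fun z => by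
    have h := (degree_torus hn z).trans (degree_torus hn x).symm
    exact Nat.eq_of_mul_eq_mul_left (by split_ifs <;> norm_num) h
  have h0 : (torus n d).degree x ≠ 0 := by
    intro h
    have := degree_torus hn x
    rw [h] at this
    omega
  have h0' : ((torus n d).degree x : ℝ) ≠ 0 := by exact_mod_cast h0
  unfold stationary
  simp only [hdeg, sum_const, card_univ, Fintype.card_fun, ZMod.card, Fintype.card_fin,
    nsmul_eq_mul, Nat.cast_pow]
  rw [mul_comm, ← div_div, div_self h0', one_div]

theorem pow_succ_transition_torus (hn : 2 ≤ n) (hd : 0 < d) (t : ℕ) (x y : Fin d → ZMod n) :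
    (transition (torus n d) ^ (t + 1)) x y =
      (∑ i, (2 * (transition (torus n d) ^ t) x y
        + (transition (torus n d) ^ t) (x + Pi.single i 1) y
        + (transition (torus n d) ^ t) (x - Pi.single i 1) y)) / (4 * d) := by
  have hd' : (0 : ℝ) < d := by exact_mod_cast hd
  have h := sum_stepCount_mul x (fun z => (transition (torus n d) ^ t) z y)
  rw [pow_succ', Matrix.mul_apply]
  simp_rw [transition_torus hn hd, add_mul, Finset.sum_add_distrib, div_mul_eq_mul_div,
    ← Finset.sum_div, h]
  simp [Finset.sum_add_distrib]
  field_simp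
  ring

end Transition

/-! ### Fourier expansion of the transition probabilities. -/

section Fourier

variable {n : ℕ} [NeZero n] {d : ℕ}

open ZMod

/-- The eigenvalue of lazy random walk on the cycle at the frequency `j`. -/
noncomputable def cycleEigenvalue (j : ZMod n) : ℝ := (1 + (stdAddChar j).re) / 2

theorem four_mul_cycleEigenvalue (j : ZMod n) :
    (4 : ℂ) * cycleEigenvalue j = 2 + stdAddChar j + stdAddChar (-j) := by
  rw [AddChar.map_neg_eq_conj, add_assoc, Complex.add_conj]
  unfold cycleEigenvalue
  push_cast
  ring

theorem norm_stdAddChar (j : ZMod n) : ‖(stdAddChar j : ℂ)‖ = 1 := AddChar.norm_apply _ _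

theorem cycleEigenvalue_nonneg (j : ZMod n) : 0 ≤ cycleEigenvalue j := by
  have := (abs_le.1 ((Complex.abs_re_le_norm _).trans (norm_stdAddChar j).le)).1
  unfold cycleEigenvalue
  linarith

theorem cycleEigenvalue_le_one (j : ZMod n) : cycleEigenvalue j ≤ 1 := by
  have := (abs_le.1 ((Complex.abs_re_le_norm _).trans (norm_stdAddChar j).le)).2
  unfold cycleEigenvalue
  linarith

theorem sum_cycleEigenvalue (hn : 2 ≤ n) :
    ∑ j : ZMod n, cycleEigenvalue j = n / 2 := by
  have : Fact (1 < n) := ⟨hn⟩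
  have h := AddChar.sum_mulShift (1 : ZMod n) (isPrimitive_stdAddChar n)
  simp only [mul_one, one_ne_zero, if_false, Nat.cast_zero] at h
  unfold cycleEigenvalue
  rw [← Finset.sum_div, Finset.sum_add_distrib, ← Complex.re_sum, h]
  simp

/-- This is `cos θ ≤ 1 - 2 θ ^ 2 / π ^ 2`, valid for `|θ| ≤ π`; hence the representative of `j`
closest to `0`. -/
theorem four_mul_sq_div_le_one_sub_cycleEigenvalue (j : ZMod n) :
    4 * (j.valMinAbs.natAbs : ℝ) ^ 2 / n ^ 2 ≤ 1 - cycleEigenvalue j := by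
  have hn : (0 : ℝ) < n := by exact_mod_cast NeZero.pos n
  have h1 : (stdAddChar j : ℂ).re = Real.cos (2 * Real.pi * j.valMinAbs / n) := by
    conv_lhs => rw [← coe_valMinAbs j, stdAddChar_coe]
    rw [← Complex.exp_ofReal_mul_I_re]
    push_cast
    ring_nf
  have h2 : |2 * Real.pi * (j.valMinAbs : ℝ) / n| ≤ Real.pi := by
    have h3 : (j.valMinAbs.natAbs : ℝ) ≤ n / 2 :=
      (Nat.cast_le.2 (natAbs_valMinAbs_le j)).trans Nat.cast_div_le
    rw [Nat.cast_natAbs, Int.cast_abs] at h3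
    rw [abs_div, abs_mul, abs_of_pos Real.two_pi_pos, abs_of_pos hn, div_le_iff₀ hn]
    nlinarith [Real.pi_pos]
  have h3 := Real.cos_le_one_sub_mul_cos_sq h2
  unfold cycleEigenvalue
  rw [h1, Nat.cast_natAbs, Int.cast_abs, sq_abs]
  have h4 : 2 / Real.pi ^ 2 * (2 * Real.pi * (j.valMinAbs : ℝ) / n) ^ 2 =
      8 * (j.valMinAbs : ℝ) ^ 2 / n ^ 2 := by
    field_simp
    ring
  linarith [show 4 * (j.valMinAbs : ℝ) ^ 2 / n ^ 2 = 8 * (j.valMinAbs : ℝ) ^ 2 / n ^ 2 / 2 by ring]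

/-- The eigenvalue of lazy random walk on the torus at the frequency `ξ`. -/
noncomputable def torusEigenvalue (ξ : Fin d → ZMod n) : ℝ := (∑ i, cycleEigenvalue (ξ i)) / d

/-- The Fourier expansion of the `t`-step transition probability over the displacement `z`. -/
noncomputable def kernel (t : ℕ) (z : Fin d → ZMod n) : ℂ :=
  ((n : ℂ) ^ d)⁻¹ * ∑ ξ : Fin d → ZMod n,
    (torusEigenvalue ξ : ℂ) ^ t * ∏ i, stdAddChar (ξ i * z i)

theorem prod_cycleSum (f : ZMod n → ℂ) (z : Fin d → ZMod n) :
    ∏ i, ((n : ℂ)⁻¹ * ∑ j, f j * stdAddChar (j * z i)) =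
      ((n : ℂ) ^ d)⁻¹ * ∑ ξ : Fin d → ZMod n, ∏ i, (f (ξ i) * stdAddChar (ξ i * z i)) := by
  rw [Finset.prod_mul_distrib, Finset.prod_const, card_univ, Fintype.card_fin, inv_pow,
    Finset.prod_univ_sum, Fintype.piFinset_univ]

theorem inv_mul_sum_stdAddChar (z : ZMod n) :
    (n : ℂ)⁻¹ * ∑ j : ZMod n, stdAddChar (j * z) = if z = 0 then 1 else 0 := by
  rw [AddChar.sum_mulShift z (isPrimitive_stdAddChar n)]
  split_ifs
  · rw [ZMod.card]
    exact inv_mul_cancel₀ (Nat.cast_ne_zero.2 (NeZero.ne n))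
  · simp

theorem kernel_zero (z : Fin d → ZMod n) : kernel 0 z = if z = 0 then 1 else 0 := by
  have h := prod_cycleSum (fun _ => 1) z
  simp only [one_mul, inv_mul_sum_stdAddChar] at h
  simp only [kernel, pow_zero, one_mul, ← h, funext_iff, Pi.zero_apply]
  split_ifs with h0
  · simp [h0]
  · push Not at h0
    obtain ⟨i, hi⟩ := h0
    exact Finset.prod_eq_zero (mem_univ i) (if_neg hi)

theorem prod_stdAddChar_add_single (ξ z : Fin d → ZMod n) (i : Fin d) (a : ZMod n) :
    ∏ j, (stdAddChar (ξ j * (z + Pi.single i a : Fin d → ZMod n) j) : ℂ) =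
      stdAddChar (ξ i * a) * ∏ j, (stdAddChar (ξ j * z j) : ℂ) := by
  simp_rw [Pi.add_apply, mul_add, AddChar.map_add_eq_mul, Finset.prod_mul_distrib]
  rw [mul_comm, Finset.prod_eq_single i (fun j _ hj => by simp [hj]) (by simp), Pi.single_eq_same]

theorem kernel_succ (hd : 0 < d) (t : ℕ) (z : Fin d → ZMod n) :
    kernel (t + 1) z =
      (∑ i, (2 * kernel t z + kernel t (z + Pi.single i 1) + kernel t (z - Pi.single i 1)))
        / (4 * d) := by
  have hd' : (d : ℂ) ≠ 0 := by exact_mod_cast hd.ne'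
  rw [eq_div_iff (by simpa using hd')]
  simp only [kernel, sub_eq_add_neg, ← Pi.single_neg, prod_stdAddChar_add_single, Finset.mul_sum,
    Finset.sum_mul, ← Finset.sum_add_distrib]
  rw [Finset.sum_comm]
  refine Finset.sum_congr rfl fun ξ _ => ?_
  have h : (torusEigenvalue ξ : ℂ) * (4 * d) =
      ∑ i, (2 + stdAddChar (ξ i) + stdAddChar (-(ξ i))) := by
    simp_rw [← four_mul_cycleEigenvalue, ← Finset.mul_sum]
    unfold torusEigenvalue
    push_cast
    field_simp
  rw [pow_succ, show ∀ a b c e p : ℂ, a * (b * c * p) * e = (c * e) * (a * (b * p)) by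
    intros; ring, h, Finset.sum_mul]
  refine Finset.sum_congr rfl fun i _ => ?_
  rw [mul_one, mul_neg, mul_one]
  ring

/-- Both sides obey the same recursion in `t` and agree at time `0`. -/
theorem pow_transition_torus_eq_kernel (hn : 2 ≤ n) (hd : 0 < d) (t : ℕ)
    (x y : Fin d → ZMod n) :
    (((transition (torus n d) ^ t) x y : ℝ) : ℂ) = kernel t (x - y) := by
  induction t generalizing x with
  | zero =>
    rw [kernel_zero, pow_zero, Matrix.one_apply]
    simp only [sub_eq_zero]
    split_ifs <;> simp
  | succ t ih =>
    rw [pow_succ_transition_torus hn hd, kernel_succ hd]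
    push_cast
    simp_rw [ih, add_sub_right_comm, sub_right_comm]

end Fourier

/-! ### Return probabilities of the cycle and a bound on the mixing time. -/

section ReturnProbability

variable {n : ℕ} [NeZero n] {d : ℕ}

open ZMod

/-- The return probability at time `u` of the continuous-time walk on the cycle `ℤ_n`. -/
noncomputable def heatReturn (n : ℕ) [NeZero n] (u : ℝ) : ℝ :=
  (n : ℝ)⁻¹ * ∑ j : ZMod n, Real.exp (-(u * (1 - cycleEigenvalue j)))

theorem heatReturn_nonneg (u : ℝ) : 0 ≤ heatReturn n u := by
  unfold heatReturn; positivity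

theorem heatReturn_antitone {u v : ℝ} (h : u ≤ v) : heatReturn n v ≤ heatReturn n u := by
  unfold heatReturn
  gcongr with j
  linarith [cycleEigenvalue_le_one j]

/-- The eigenvalues average to `1 / 2`, so averaging `exp (-s) ≤ 1 - s / 2` over the frequencies
gives the bound, uniformly in `n`. -/
theorem heatReturn_le_one_sub (hn : 2 ≤ n) {u : ℝ} (h0 : 0 ≤ u) (h1 : u ≤ 1) :
    heatReturn n u ≤ 1 - u / 4 := by
  have hn' : (0 : ℝ) < n := by exact_mod_cast NeZero.pos n
  have key : ∀ s : ℝ, 0 ≤ s → s ≤ 1 → Real.exp (-s) ≤ 1 - s / 2 := by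
    intro s hs0 hs1
    have h2 := Real.add_one_le_exp s
    have h3 : (1 - s / 2) * (s + 1) ≥ 1 := by nlinarith
    rw [Real.exp_neg, inv_le_comm₀ (Real.exp_pos s) (by linarith)]
    refine le_trans ?_ h2
    rw [inv_le_iff_one_le_mul₀ (by linarith)]
    linarith
  unfold heatReturn
  calc _ ≤ (n : ℝ)⁻¹ * ∑ j : ZMod n, (1 - u * (1 - cycleEigenvalue j) / 2) := by
        gcongr with j
        have h2 := cycleEigenvalue_le_one j
        have h3 := cycleEigenvalue_nonneg j
        refine key _ (mul_nonneg h0 (by linarith)) ?_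
        nlinarith
    _ = 1 - u / 4 := by
        rw [Finset.sum_sub_distrib, ← Finset.sum_div, ← Finset.mul_sum, Finset.sum_sub_distrib,
          sum_cycleEigenvalue hn]
        simp
        field_simp
        ring

theorem heatReturn_le_exp (hn : 2 ≤ n) {u : ℝ} (h0 : 0 ≤ u) (h1 : u ≤ 1) :
    heatReturn n u ≤ Real.exp (-(u / 4)) :=
  (heatReturn_le_one_sub hn h0 h1).trans (Real.one_sub_le_exp_neg _)

theorem exp_cycleEigenvalue_le {u : ℝ} (hu : 0 ≤ u) (j : ZMod n) :
    Real.exp (-(u * (1 - cycleEigenvalue j))) ≤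
      Real.exp (-(u * (4 * (j.valMinAbs.natAbs : ℝ) ^ 2 / n ^ 2))) := by
  gcongr
  exact four_mul_sq_div_le_one_sub_cycleEigenvalue j

theorem exp_neg_le_inv {a : ℝ} (ha : 0 < a) : Real.exp (-a) ≤ a⁻¹ := by
  rw [Real.exp_neg]
  exact inv_anti₀ ha (by linarith [Real.add_one_le_exp a])

theorem card_valMinAbs_le (J : ℕ) :
    #{j : ZMod n | j.valMinAbs.natAbs ≤ J} ≤ 2 * J + 1 := by
  have h : #{j : ZMod n | j.valMinAbs.natAbs ≤ J} ≤ #(Finset.Icc (-(J : ℤ)) J) := by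
    refine Finset.card_le_card_of_injOn (fun j => j.valMinAbs) ?_ ?_
    · intro j hj
      simp only [coe_filter, mem_univ, true_and, Set.mem_ofPred_eq] at hj
      simp only [coe_Icc, Set.mem_Icc]
      omega
    · exact fun a _ b _ hab => injective_valMinAbs hab
  refine h.trans ?_
  rw [Int.card_Icc]
  omega

/-- A heat kernel bound on the cycle, weaker than the optimal `u ^ (-1 / 2)`. -/
theorem heatReturn_pow_four_le {w : ℝ} (hw : 1 ≤ w) :
    heatReturn n (w ^ 4) ≤ 3 * w⁻¹ + (n : ℝ)⁻¹ := by
  have hn : (0 : ℝ) < n := by exact_mod_cast NeZero.pos n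
  have hw0 : 0 < w := by linarith
  -- Cut-off in frequency: the at most `2 J + 1` low frequencies contribute at most `1` each, while
  -- above the cut-off the exponent is at least `4 w ^ 2 ≥ w`, so each term is at most `1 / w`.
  set J := ⌊(n : ℝ) / w⌋₊
  have hJ : (J : ℝ) ≤ n / w := Nat.floor_le (by positivity)
  have hterm : ∀ j : ZMod n, Real.exp (-(w ^ 4 * (1 - cycleEigenvalue j))) ≤
      (if j.valMinAbs.natAbs ≤ J then 1 else 0) + w⁻¹ := by
    intro j
    split_ifs with hj
    · have : Real.exp (-(w ^ 4 * (1 - cycleEigenvalue j))) ≤ 1 := by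
        rw [Real.exp_le_one_iff, neg_nonpos]
        exact mul_nonneg (by positivity) (by linarith [cycleEigenvalue_le_one j])
      linarith [inv_pos.2 hw0]
    · rw [zero_add]
      have h1 : (n : ℝ) / w < j.valMinAbs.natAbs := by
        exact (Nat.floor_lt (by positivity)).1 (not_le.1 hj)
      refine (exp_cycleEigenvalue_le (by positivity) j).trans ?_
      have h2 : w ≤ w ^ 4 * (4 * (j.valMinAbs.natAbs : ℝ) ^ 2 / n ^ 2) := by
        calc w ≤ w ^ 4 * (4 * (n / w) ^ 2 / n ^ 2) := by
              rw [show w ^ 4 * (4 * ((n : ℝ) / w) ^ 2 / n ^ 2) = 4 * w ^ 2 by field_simp]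
              nlinarith
          _ ≤ _ := by gcongr
      exact (exp_neg_le_inv (hw0.trans_le h2)).trans (inv_anti₀ hw0 h2)
  unfold heatReturn
  calc _ ≤ (n : ℝ)⁻¹ * ∑ j : ZMod n, ((if j.valMinAbs.natAbs ≤ J then 1 else 0) + w⁻¹) := by
        gcongr with j
        exact hterm j
    _ = (n : ℝ)⁻¹ * #{j : ZMod n | j.valMinAbs.natAbs ≤ J} + w⁻¹ := by
        rw [Finset.sum_add_distrib, Finset.sum_boole, sum_const, card_univ, ZMod.card,
          nsmul_eq_mul, mul_add, inv_mul_cancel_left₀ hn.ne']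
    _ ≤ (n : ℝ)⁻¹ * (2 * (n / w) + 1) + w⁻¹ := by
        gcongr
        calc (#{j : ZMod n | j.valMinAbs.natAbs ≤ J} : ℝ) ≤ ((2 * J + 1 : ℕ) : ℝ) :=
              Nat.cast_le.2 (card_valMinAbs_le J)
          _ ≤ _ := by push_cast; linarith
    _ = 3 * w⁻¹ + (n : ℝ)⁻¹ := by field_simp; ring

/-- The eighth power turns the decay `u ^ (-1 / 4)` into the summable `u ^ (-2)`, and makes the `1 /
n` term small enough to survive summation over `O(n ^ 3 d ^ 2)` times. -/
theorem heatReturn_pow_eight_le {u : ℝ} (hu : 1 ≤ u) :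
    heatReturn n u ^ 8 ≤ 6 ^ 8 * (u⁻¹ ^ 2 + (n : ℝ)⁻¹ ^ 8) := by
  have hu0 : 0 ≤ u := by linarith
  set w := √√u
  have hw4 : w ^ 4 = u := by
    rw [show w ^ 4 = (w ^ 2) ^ 2 by ring, Real.sq_sqrt (Real.sqrt_nonneg _), Real.sq_sqrt hu0]
  have hw : 1 ≤ w := Real.one_le_sqrt.2 (Real.one_le_sqrt.2 hu)
  have hw8 : w⁻¹ ^ 8 = u⁻¹ ^ 2 := by rw [← hw4]; ring
  have h := heatReturn_pow_four_le (n := n) hw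
  rw [hw4] at h
  have hw0 : 0 ≤ w⁻¹ := by positivity
  have hn0 : 0 ≤ (n : ℝ)⁻¹ := by positivity
  rw [← hw8]
  rcases le_total w⁻¹ (n : ℝ)⁻¹ with hc | hc
  · calc heatReturn n u ^ 8 ≤ (6 * (n : ℝ)⁻¹) ^ 8 :=
          pow_le_pow_left₀ (heatReturn_nonneg u) (by linarith) 8
      _ ≤ _ := by rw [mul_pow]; gcongr; linarith [pow_nonneg hw0 8]
  · calc heatReturn n u ^ 8 ≤ (6 * w⁻¹) ^ 8 :=
          pow_le_pow_left₀ (heatReturn_nonneg u) (by linarith) 8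
      _ ≤ _ := by rw [mul_pow]; gcongr; linarith [pow_nonneg hn0 8]

theorem natCast_mul_heatReturn_le {u : ℝ} (hu : 0 < u) :
    n * heatReturn n u ≤ 1 + n * (n ^ 2 / (4 * u)) := by
  have hn : (0 : ℝ) < n := by exact_mod_cast NeZero.pos n
  unfold heatReturn
  rw [mul_inv_cancel_left₀ hn.ne']
  calc _ ≤ ∑ j : ZMod n, ((if j = 0 then 1 else 0) + (n : ℝ) ^ 2 / (4 * u)) := by
        refine Finset.sum_le_sum fun j _ => (exp_cycleEigenvalue_le hu.le j).trans ?_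
        split_ifs with hj
        · subst hj
          simp
          positivity
        · have h1 : 1 ≤ (j.valMinAbs.natAbs : ℝ) := by
            have : j.valMinAbs.natAbs ≠ 0 := by simpa using hj
            exact_mod_cast Nat.one_le_iff_ne_zero.2 this
          rw [zero_add]
          refine (exp_neg_le_inv (by positivity)).trans ?_
          rw [inv_le_comm₀ (by positivity) (by positivity), inv_div]
          calc 4 * u / (n : ℝ) ^ 2 = u * (4 * 1 ^ 2 / n ^ 2) := by ring
            _ ≤ _ := by gcongr
    _ = _ := by simp [Finset.sum_add_distrib]

theorem torusEigenvalue_nonneg (ξ : Fin d → ZMod n) : 0 ≤ torusEigenvalue ξ :=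
  div_nonneg (Finset.sum_nonneg fun _ _ => cycleEigenvalue_nonneg _) (Nat.cast_nonneg _)

theorem mul_one_sub_torusEigenvalue (hd : 0 < d) (t : ℝ) (ξ : Fin d → ZMod n) :
    t * (1 - torusEigenvalue ξ) = ∑ i, t / d * (1 - cycleEigenvalue (ξ i)) := by
  have hd' : (d : ℝ) ≠ 0 := by exact_mod_cast hd.ne'
  unfold torusEigenvalue
  rw [← Finset.mul_sum, Finset.sum_sub_distrib]
  simp
  field_simp

/-- By `a ≤ exp (-(1 - a))` discrete time is dominated by continuous time, where the contribution of
a frequency factorises over the coordinates. -/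
theorem torusEigenvalue_pow_le (hd : 0 < d) (t : ℕ) (ξ : Fin d → ZMod n) :
    torusEigenvalue ξ ^ t ≤ ∏ i, Real.exp (-((t : ℝ) / d * (1 - cycleEigenvalue (ξ i)))) := by
  rw [← Real.exp_sum, Finset.sum_neg_distrib, ← mul_one_sub_torusEigenvalue hd, ← mul_neg,
    Real.exp_nat_mul]
  refine pow_le_pow_left₀ (torusEigenvalue_nonneg ξ) ?_ t
  linarith [Real.add_one_le_exp (-(1 - torusEigenvalue ξ))]

theorem sum_torusEigenvalue_pow_le (hd : 0 < d) (t : ℕ) :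
    ∑ ξ : Fin d → ZMod n, torusEigenvalue ξ ^ t ≤ (n * heatReturn n ((t : ℝ) / d)) ^ d := by
  have hn : (n : ℝ) ≠ 0 := by exact_mod_cast NeZero.ne n
  unfold heatReturn
  rw [mul_inv_cancel_left₀ hn, ← Fin.prod_const, Finset.prod_univ_sum, Fintype.piFinset_univ]
  exact Finset.sum_le_sum fun ξ _ => torusEigenvalue_pow_le hd t ξ

theorem norm_kernel_le (hd : 0 < d) (t : ℕ) (z : Fin d → ZMod n) :
    ‖kernel t z‖ ≤ heatReturn n ((t : ℝ) / d) ^ d := by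
  have hn : (0 : ℝ) < n := by exact_mod_cast NeZero.pos n
  have h := sum_torusEigenvalue_pow_le (n := n) hd t
  rw [mul_pow, ← inv_mul_le_iff₀ (by positivity)] at h
  refine le_trans ?_ h
  unfold kernel
  rw [norm_mul, norm_inv, norm_pow, Complex.norm_natCast]
  gcongr
  refine (norm_sum_le _ _).trans_eq (Finset.sum_congr rfl fun ξ _ => ?_)
  rw [norm_mul, norm_pow, norm_prod]
  simp only [norm_stdAddChar, prod_const_one, mul_one, Complex.norm_real,
    Real.norm_of_nonneg (torusEigenvalue_nonneg ξ)]

theorem pow_transition_torus_le (hn : 2 ≤ n) (hd : 0 < d) (t : ℕ) (x y : Fin d → ZMod n) :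
    (transition (torus n d) ^ t) x y ≤ heatReturn n ((t : ℝ) / d) ^ d := by
  have h := norm_kernel_le hd t (x - y)
  rw [← pow_transition_torus_eq_kernel hn hd, Complex.norm_real] at h
  exact (le_abs_self _).trans h

theorem torusEigenvalue_zero (hd : 0 < d) : torusEigenvalue (0 : Fin d → ZMod n) = 1 := by
  have hd' : (d : ℝ) ≠ 0 := by exact_mod_cast hd.ne'
  simp [torusEigenvalue, cycleEigenvalue, hd']

/-- The zero frequency contributes exactly the stationary part `1`; the other terms are bounded in
absolute value. -/
theorem norm_card_mul_kernel_sub_one_le (hd : 0 < d) (t : ℕ) (z : Fin d → ZMod n) :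
    ‖(n : ℂ) ^ d * kernel t z - 1‖ ≤ (n * heatReturn n ((t : ℝ) / d)) ^ d - 1 := by
  have hn : (n : ℂ) ≠ 0 := by exact_mod_cast NeZero.ne n
  refine le_trans ?_ (sub_le_sub_right (sum_torusEigenvalue_pow_le hd t) 1)
  unfold kernel
  rw [mul_inv_cancel_left₀ (pow_ne_zero _ hn), ← Finset.add_sum_erase _ _ (mem_univ 0),
    ← Finset.add_sum_erase _ (fun ξ : Fin d → ZMod n => torusEigenvalue ξ ^ t) (mem_univ 0)]
  simp only [torusEigenvalue_zero hd, Pi.zero_apply, zero_mul, AddChar.map_zero_eq_one,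
    prod_const_one, Complex.ofReal_one, one_pow, mul_one, add_sub_cancel_left]
  refine (norm_sum_le _ _).trans_eq (Finset.sum_congr rfl fun ξ _ => ?_)
  rw [norm_mul, norm_pow, norm_prod]
  simp only [norm_stdAddChar, prod_const_one, mul_one, Complex.norm_real,
    Real.norm_of_nonneg (torusEigenvalue_nonneg ξ)]

theorem tUnif_torus_le (hn : 2 ≤ n) (hd : 0 < d) : tUnif (torus n d) ≤ 3 * n ^ 3 * d ^ 2 := by
  have hn0 : (0 : ℝ) < n := by exact_mod_cast NeZero.pos n
  have hd' : (0 : ℝ) < d := by exact_mod_cast hd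
  refine Nat.sInf_le fun x y => ?_
  rw [stationary_torus hn hd]
  set t := 3 * n ^ 3 * d ^ 2 with ht
  have h1 := norm_card_mul_kernel_sub_one_le hd t (x - y)
  rw [← pow_transition_torus_eq_kernel hn hd,
    show (n : ℂ) ^ d * ((transition (torus n d) ^ t) x y : ℝ) - 1 =
      (((n : ℝ) ^ d * (transition (torus n d) ^ t) x y - 1 : ℝ) : ℂ) by push_cast; rfl,
    Complex.norm_real, Real.norm_eq_abs] at h1
  have h2 : ((transition (torus n d) ^ t) x y - ((n : ℝ) ^ d)⁻¹) / ((n : ℝ) ^ d)⁻¹ =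
      (n : ℝ) ^ d * (transition (torus n d) ^ t) x y - 1 := by field_simp
  rw [h2]
  refine h1.trans ?_
  -- At `t / d = 3 n ^ 3 d` the error `n ^ 3 / (4 t / d)` is `1 / (12 d)`. The `d`-th power is then
  -- at most `exp (1 / 12) ≤ 12 / 11`, and `1 / 11 ≤ 1 / 6 ≤ 1 / (2 e)`.
  have h3 : (n : ℝ) * heatReturn n ((t : ℝ) / d) ≤ 1 / 12 / d + 1 := by
    refine (natCast_mul_heatReturn_le (by rw [ht]; positivity)).trans_eq ?_
    rw [ht]
    push_cast
    field_simp
    ring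
  have h4 : ((n : ℝ) * heatReturn n ((t : ℝ) / d)) ^ d ≤ Real.exp (1 / 12) :=
    calc _ ≤ Real.exp (1 / 12 / d) ^ d :=
          pow_le_pow_left₀ (mul_nonneg hn0.le (heatReturn_nonneg _))
            (h3.trans (Real.add_one_le_exp _)) d
      _ = _ := by rw [← Real.exp_nat_mul]; congr 1; field_simp
  have h5 : Real.exp (1 / 12) ≤ 1 / (1 - 1 / 12) :=
    Real.exp_bound_div_one_sub_of_interval (by norm_num) (by norm_num)
  have h6 : (1 / 6 : ℝ) ≤ (2 * Real.exp 1)⁻¹ := by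
    rw [one_div]
    exact inv_anti₀ (by positivity) (by linarith [Real.exp_one_lt_d9])
  norm_num at h5
  linarith

end ReturnProbability

/-! ### The continuous-time walk and comparison with discrete time. -/

section HeatKernel

variable {n : ℕ} [NeZero n] {d : ℕ}

open ZMod

/-- The `m`-step transition probabilities of lazy random walk on the cycle, as a function of the
displacement. -/
noncomputable def cycleKernel (n : ℕ) : ℕ → ZMod n → ℝ
  | 0, z => if z = 0 then 1 else 0
  | m + 1, z => (2 * cycleKernel n m z + cycleKernel n m (z + 1) + cycleKernel n m (z - 1)) / 4

theorem cycleKernel_nonneg (m : ℕ) (z : ZMod n) : 0 ≤ cycleKernel n m z := by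
  induction m generalizing z with
  | zero => unfold cycleKernel; split_ifs <;> norm_num
  | succ m ih =>
    unfold cycleKernel
    linarith [ih z, ih (z + 1), ih (z - 1)]

theorem cycleKernel_le_one (m : ℕ) (z : ZMod n) : cycleKernel n m z ≤ 1 := by
  induction m generalizing z with
  | zero => unfold cycleKernel; split_ifs <;> norm_num
  | succ m ih =>
    unfold cycleKernel
    linarith [ih z, ih (z + 1), ih (z - 1)]

theorem natAbs_valMinAbs_le_add (a b : ZMod n) :
    a.valMinAbs.natAbs ≤ (a + b).valMinAbs.natAbs + b.valMinAbs.natAbs := by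
  have h := natAbs_valMinAbs_add_le (a + b) (-b)
  rw [add_neg_cancel_right] at h
  refine (h.trans (Int.natAbs_add_le _ _)).trans_eq ?_
  rw [natAbs_valMinAbs_neg]

theorem natAbs_valMinAbs_one_le : (1 : ZMod n).valMinAbs.natAbs ≤ 1 := by
  rw [valMinAbs_natAbs_eq_min, val_one_eq_one_mod]
  exact (min_le_left _ _).trans (Nat.mod_le _ _)

theorem cycleKernel_eq_zero {m : ℕ} {z : ZMod n} (h : m < z.valMinAbs.natAbs) :
    cycleKernel n m z = 0 := by
  induction m generalizing z with
  | zero =>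
    unfold cycleKernel
    rw [if_neg]
    rintro rfl
    simp at h
  | succ m ih =>
    have h1 := natAbs_valMinAbs_le_add z 1
    have h2 := natAbs_valMinAbs_le_add z (-1)
    rw [natAbs_valMinAbs_neg, ← sub_eq_add_neg] at h2
    have h3 := natAbs_valMinAbs_one_le (n := n)
    unfold cycleKernel
    rw [ih (by omega), ih (by omega), ih (by omega)]
    norm_num

theorem cycleKernel_eq_sum (m : ℕ) (z : ZMod n) :
    (cycleKernel n m z : ℂ) =
      (n : ℂ)⁻¹ * ∑ j : ZMod n, (cycleEigenvalue j : ℂ) ^ m * stdAddChar (j * z) := by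
  induction m generalizing z with
  | zero =>
    simp only [pow_zero, one_mul, inv_mul_sum_stdAddChar, cycleKernel]
    split_ifs <;> simp
  | succ m ih =>
    unfold cycleKernel
    push_cast
    rw [ih, ih, ih, div_eq_iff (by norm_num), mul_assoc, mul_left_comm, ← mul_add, ← mul_add,
      Finset.mul_sum, ← Finset.sum_add_distrib, ← Finset.sum_add_distrib, Finset.sum_mul]
    congr 1
    refine Finset.sum_congr rfl fun j _ => ?_
    rw [pow_succ, sub_eq_add_neg, mul_add, mul_add, AddChar.map_add_eq_mul,
      AddChar.map_add_eq_mul, mul_neg, mul_one,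
      show ∀ a b c e : ℂ, a * b * c * e = (e * b) * (a * c) by intros; ring,
      four_mul_cycleEigenvalue]
    ring

/-- The transition probabilities of the continuous-time walk on the cycle. -/
noncomputable def heatKernel (u : ℝ) (z : ZMod n) : ℝ :=
  ∑' m : ℕ, Real.exp (-u) * (u ^ m / m.factorial) * cycleKernel n m z

theorem hasSum_poisson (u : ℝ) :
    HasSum (fun m : ℕ => Real.exp (-u) * (u ^ m / m.factorial)) 1 := by
  have h := (NormedSpace.expSeries_div_hasSum_exp u).mul_left (Real.exp (-u))
  rwa [← Real.exp_eq_exp_ℝ, ← Real.exp_add, neg_add_cancel, Real.exp_zero] at h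

/-- The Poisson generating function: a Poisson number of steps turns an eigenvalue power `a ^ m`
into `exp (-u (1 - a))`. -/
theorem hasSum_poisson_mul_pow (u a : ℝ) :
    HasSum (fun m : ℕ => Real.exp (-u) * (u ^ m / m.factorial) * a ^ m)
      (Real.exp (-(u * (1 - a)))) := by
  have h := (NormedSpace.expSeries_div_hasSum_exp (u * a)).mul_left (Real.exp (-u))
  rw [← Real.exp_eq_exp_ℝ, ← Real.exp_add, show -u + u * a = -(u * (1 - a)) by ring] at h
  refine h.congr_fun fun m => ?_
  rw [mul_pow]
  ring

theorem poisson_nonneg {u : ℝ} (hu : 0 ≤ u) (m : ℕ) :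
    0 ≤ Real.exp (-u) * (u ^ m / m.factorial) := by positivity

theorem summable_heatKernel {u : ℝ} (hu : 0 ≤ u) (z : ZMod n) :
    Summable fun m : ℕ => Real.exp (-u) * (u ^ m / m.factorial) * cycleKernel n m z :=
  Summable.of_nonneg_of_le
    (fun m => mul_nonneg (poisson_nonneg hu m) (cycleKernel_nonneg m z))
    (fun m => mul_le_of_le_one_right (poisson_nonneg hu m) (cycleKernel_le_one m z))
    (hasSum_poisson u).summable

theorem heatKernel_nonneg {u : ℝ} (hu : 0 ≤ u) (z : ZMod n) : 0 ≤ heatKernel u z :=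
  tsum_nonneg fun m => mul_nonneg (poisson_nonneg hu m) (cycleKernel_nonneg m z)

/-- At least `j` steps are needed to cover the distance, and a Poisson variable of mean `u` is at
least `j` with probability at most `u ^ j`: its weight at `m + j` is at most `u ^ j` times its
weight at `m`. -/
theorem heatKernel_le_pow {u : ℝ} (hu : 0 ≤ u) {z : ZMod n} {j : ℕ}
    (hj : j ≤ z.valMinAbs.natAbs) : heatKernel u z ≤ u ^ j := by
  have hs := summable_heatKernel hu z
  unfold heatKernel
  rw [← hs.sum_add_tsum_nat_add j, Finset.sum_eq_zero, zero_add]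
  · have hg := (hasSum_poisson u).mul_left (u ^ j)
    rw [mul_one] at hg
    rw [← hg.tsum_eq]
    refine ((summable_nat_add_iff j).2 hs).tsum_le_tsum (fun m => ?_) hg.summable
    refine (mul_le_of_le_one_right (poisson_nonneg hu _) (cycleKernel_le_one _ z)).trans ?_
    rw [show u ^ j * (Real.exp (-u) * (u ^ m / m.factorial)) =
      Real.exp (-u) * (u ^ (m + j) / m.factorial) by ring]
    gcongr
    omega
  · intro m hm
    rw [cycleKernel_eq_zero ((mem_range.1 hm).trans_le hj), mul_zero]

theorem heatKernel_eq_sum {u : ℝ} (hu : 0 ≤ u) (z : ZMod n) :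
    (heatKernel u z : ℂ) = (n : ℂ)⁻¹ * ∑ j : ZMod n,
      (Real.exp (-(u * (1 - cycleEigenvalue j))) : ℂ) * stdAddChar (j * z) := by
  have h1 := Complex.hasSum_ofReal.2 (summable_heatKernel hu z).hasSum
  refine h1.unique ?_
  have h2 := (hasSum_sum (s := univ) fun (j : ZMod n) _ =>
    (Complex.hasSum_ofReal.2 (hasSum_poisson_mul_pow u (cycleEigenvalue j))).mul_right
      (stdAddChar (j * z) : ℂ)).mul_left (n : ℂ)⁻¹
  refine h2.congr_fun fun m => ?_
  rw [Complex.ofReal_mul, cycleKernel_eq_sum, mul_left_comm, Finset.mul_sum]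
  congr 1
  refine Finset.sum_congr rfl fun j _ => ?_
  push_cast
  ring

/-- The Fourier coefficients are positive, so displacement `0` is the most likely one. -/
theorem heatKernel_le_heatReturn {u : ℝ} (hu : 0 ≤ u) (z : ZMod n) :
    heatKernel u z ≤ heatReturn n u := by
  have h : ‖(heatKernel u z : ℂ)‖ ≤ heatReturn n u := by
    rw [heatKernel_eq_sum hu, norm_mul, norm_inv, Complex.norm_natCast]
    unfold heatReturn
    gcongr
    refine (norm_sum_le _ _).trans_eq (Finset.sum_congr rfl fun j _ => ?_)
    rw [norm_mul, norm_stdAddChar, mul_one, Complex.norm_real,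
      Real.norm_of_nonneg (Real.exp_pos _).le]
  rw [Complex.norm_real] at h
  exact (le_abs_self _).trans h

/-- The continuous-time walk on the torus has independent coordinates. -/
theorem hasSum_poisson_mul_transition (hn : 2 ≤ n) (hd : 0 < d) {s : ℝ} (hs : 0 ≤ s)
    (x y : Fin d → ZMod n) :
    HasSum (fun m : ℕ =>
        Real.exp (-s) * (s ^ m / m.factorial) * (transition (torus n d) ^ m) x y)
      (∏ i, heatKernel (s / d) (x i - y i)) := by
  have h := (hasSum_sum (s := univ) fun (ξ : Fin d → ZMod n) _ =>
    (Complex.hasSum_ofReal.2 (hasSum_poisson_mul_pow s (torusEigenvalue ξ))).mul_right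
      (∏ i, stdAddChar (ξ i * (x i - y i)) : ℂ)).mul_left ((n : ℂ) ^ d)⁻¹
  -- The exponent is a sum over the coordinates, so the Fourier sum on the torus is a product of
  -- Fourier sums on the cycle.
  have hv : ((∏ i, heatKernel (s / d) (x i - y i) : ℝ) : ℂ) =
      ((n : ℂ) ^ d)⁻¹ * ∑ ξ : Fin d → ZMod n,
        ((Real.exp (-(s * (1 - torusEigenvalue ξ))) : ℝ) : ℂ) *
          ∏ i, stdAddChar (ξ i * (x i - y i)) := by
    rw [Complex.ofReal_prod]
    simp_rw [heatKernel_eq_sum (div_nonneg hs d.cast_nonneg)]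
    rw [prod_cycleSum (fun j => ((Real.exp (-(s / d * (1 - cycleEigenvalue j))) : ℝ) : ℂ))
      (fun i => x i - y i)]
    congr 1
    refine Finset.sum_congr rfl fun ξ _ => ?_
    rw [Finset.prod_mul_distrib, mul_one_sub_torusEigenvalue hd, ← Finset.sum_neg_distrib,
      Real.exp_sum, Complex.ofReal_prod]
  rw [← Complex.hasSum_ofReal, hv]
  refine h.congr_fun fun m => ?_
  rw [Complex.ofReal_mul, pow_transition_torus_eq_kernel hn hd]
  unfold kernel
  rw [mul_left_comm, Finset.mul_sum]
  congr 1
  refine Finset.sum_congr rfl fun ξ _ => ?_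
  push_cast
  simp only [Pi.sub_apply]
  ring

/-- A crude Stirling bound with `t` in place of `√t`; the induction step reduces to `(t / (t + 1)) ^
(t + 1) ≤ 1 / e`. -/
theorem factorial_le_mul_pow (t : ℕ) (ht : 1 ≤ t) :
    (t.factorial : ℝ) ≤ Real.exp 1 * t * (t ^ t * Real.exp (-t)) := by
  induction t, ht using Nat.le_induction with
  | base => simp [← Real.exp_add]
  | succ t ht ih =>
    have ht0 : (0 : ℝ) < t := by exact_mod_cast ht
    have h1 : (t : ℝ) / (t + 1) ≤ Real.exp (-(1 / (t + 1))) := by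
      have := Real.add_one_le_exp (-(1 / ((t : ℝ) + 1)))
      refine le_trans (le_of_eq ?_) this
      field_simp
      ring
    have h2 : ((t : ℝ) / (t + 1)) ^ (t + 1) ≤ Real.exp (-1) := by
      refine (pow_le_pow_left₀ (by positivity) h1 (t + 1)).trans_eq ?_
      rw [← Real.exp_nat_mul]
      congr 1
      push_cast
      field_simp
    rw [div_pow, div_le_iff₀ (by positivity)] at h2
    rw [Nat.factorial_succ]
    push_cast
    calc ((t : ℝ) + 1) * t.factorial
        ≤ (t + 1) * (Real.exp 1 * t * (t ^ t * Real.exp (-t))) := by gcongr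
      _ = (t + 1) * Real.exp 1 * Real.exp (-t) * t ^ (t + 1) := by ring
      _ ≤ (t + 1) * Real.exp 1 * Real.exp (-t) * (Real.exp (-1) * (t + 1) ^ (t + 1)) := by gcongr
      _ = _ := by rw [neg_add, Real.exp_add]; ring

/-- A lower bound for the Poisson weight at its mean; `t + 1` instead of `t` includes the case `t =
0`. -/
theorem one_le_mul_poisson (t : ℕ) :
    1 ≤ Real.exp 1 * (t + 1) * (Real.exp (-t) * ((t : ℝ) ^ t / t.factorial)) := by
  have hf : (0 : ℝ) < t.factorial := by exact_mod_cast t.factorial_pos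
  rw [show Real.exp 1 * ((t : ℝ) + 1) * (Real.exp (-t) * ((t : ℝ) ^ t / t.factorial)) =
    Real.exp 1 * (t + 1) * ((t : ℝ) ^ t * Real.exp (-t)) / t.factorial by ring, le_div_iff₀ hf,
    one_mul]
  rcases Nat.eq_zero_or_pos t with rfl | ht
  · simp
  · refine (factorial_le_mul_pow t ht).trans ?_
    gcongr
    linarith

/-- All terms of the Poisson average at `s = t` are nonnegative, so the term `m = t` alone is at
most the product of heat kernels. -/
theorem pow_transition_torus_le_prod (hn : 2 ≤ n) (hd : 0 < d) (t : ℕ)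
    (x y : Fin d → ZMod n) :
    (transition (torus n d) ^ t) x y ≤
      Real.exp 1 * (t + 1) * ∏ i, heatKernel ((t : ℝ) / d) (x i - y i) := by
  have hp := pow_nonneg' (torus n d)
  have h := le_hasSum (hasSum_poisson_mul_transition hn hd t.cast_nonneg x y) t
    fun m _ => mul_nonneg (poisson_nonneg t.cast_nonneg m) (hp m x y)
  calc (transition (torus n d) ^ t) x y
      ≤ Real.exp 1 * (t + 1) * (Real.exp (-t) * ((t : ℝ) ^ t / t.factorial)) *
          (transition (torus n d) ^ t) x y :=
        le_mul_of_one_le_left (hp t x y) (one_le_mul_poisson t)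
    _ ≤ _ := by rw [mul_assoc]; gcongr

end HeatKernel

/-- Truncates the coordinate distances to total exactly `k`, so that at most `k` coordinates are
charged for moving even when the actual distance is larger. -/
theorem exists_le_sum_eq {ι : Type*} [Fintype ι] (m : ι → ℕ) {k : ℕ}
    (hk : k ≤ ∑ i, m i) : ∃ f : ι → ℕ, f ≤ m ∧ ∑ i, f i = k := by
  classical
  induction k with
  | zero => exact ⟨0, fun i => Nat.zero_le _, by simp⟩
  | succ k ih =>
    obtain ⟨f, hf, hs⟩ := ih (by omega)
    obtain ⟨i, -, hi⟩ := Finset.exists_lt_of_sum_lt (s := univ) (f := f) (g := m) (by omega)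
    refine ⟨f + Pi.single i 1, fun j => ?_, by simp [Finset.sum_add_distrib, hs]⟩
    by_cases hj : j = i
    · subst hj; simpa using hi
    · simpa [hj] using hf j

/-! ### Times up to `d`, where the distance matters. -/

section SmallTimes

variable {n : ℕ} [NeZero n] {d : ℕ}

theorem prod_heatKernel_le {u : ℝ} (h0 : 0 ≤ u) (h1 : heatReturn n u ≤ 1) {k : ℕ}
    {x y : Fin d → ZMod n} (hk : k ≤ l1dist x y) :
    ∏ i, heatKernel u (x i - y i) ≤ u ^ k * heatReturn n u ^ (d - k) := by
  obtain ⟨f, hf, hs⟩ := exists_le_sum_eq (fun i => (x i - y i).valMinAbs.natAbs) hk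
  have hr := heatReturn_nonneg (n := n) u
  calc ∏ i, heatKernel u (x i - y i)
      ≤ ∏ i, (u ^ f i * if f i = 0 then heatReturn n u else 1) := by
        refine Finset.prod_le_prod (fun i _ => heatKernel_nonneg h0 _) fun i _ => ?_
        split_ifs with hi
        · rw [hi, pow_zero, one_mul]
          exact heatKernel_le_heatReturn h0 _
        · rw [mul_one]
          exact heatKernel_le_pow h0 (hf i)
    _ = u ^ k * heatReturn n u ^ #{i | f i = 0} := by
        rw [Finset.prod_mul_distrib, Finset.prod_pow_eq_pow_sum, hs, Finset.prod_ite,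
          Finset.prod_const, Finset.prod_const_one, mul_one]
    _ ≤ _ := by
        refine mul_le_mul_of_nonneg_left (pow_le_pow_of_le_one hr h1 ?_) (pow_nonneg h0 k)
        have h2 : #{i | ¬ f i = 0} ≤ k := by
          rw [← hs, Finset.card_eq_sum_ones]
          refine (Finset.sum_le_sum fun i hi => ?_).trans
            (Finset.sum_le_sum_of_subset (Finset.filter_subset _ univ))
          exact Nat.one_le_iff_ne_zero.2 (mem_filter.1 hi).2
        have h3 := Finset.card_filter_add_card_filter_not (s := univ) (fun i => f i = 0)
        rw [card_univ, Fintype.card_fin] at h3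
        omega

theorem pow_transition_torus_le_of_le (hn : 2 ≤ n) {k : ℕ} (hd : 0 < d) (hk : 8 * k ≤ d)
    {x y : Fin d → ZMod n} (hxy : k ≤ l1dist x y) {t : ℕ} (ht : t ≤ d) :
    (transition (torus n d) ^ t) x y ≤
      Real.exp 1 * ((t + 1) * t ^ k * Real.exp (-(7 / 32) * t)) / (d : ℝ) ^ k := by
  have hd' : (0 : ℝ) < d := by exact_mod_cast hd
  have hu0 : 0 ≤ (t : ℝ) / d := by positivity
  have hu1 : (t : ℝ) / d ≤ 1 := (div_le_one hd').2 (by exact_mod_cast ht)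
  have h1 := heatReturn_le_exp hn hu0 hu1
  -- The rate is `7 / 32 = (1 / 4) (7 / 8)`, since `k ≤ d / 8` leaves `d - k ≥ 7 d / 8` factors.
  have h2 : heatReturn n ((t : ℝ) / d) ^ (d - k) ≤ Real.exp (-(7 / 32) * t) := by
    refine (pow_le_pow_left₀ (heatReturn_nonneg _) h1 _).trans ?_
    rw [← Real.exp_nat_mul, Nat.cast_sub (by omega), Real.exp_le_exp]
    have hk' : (8 * k : ℝ) ≤ d := by exact_mod_cast hk
    have h3 : (t : ℝ) / d * (7 / 8 * d) ≤ t / d * (d - k) := by gcongr; linarith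
    have h4 : (t : ℝ) / d * (7 / 8 * d) = 7 / 8 * t := by field_simp
    linear_combination (1 / 4) * h3 - (1 / 4) * h4
  refine (pow_transition_torus_le_prod hn hd t x y).trans ?_
  calc _ ≤ Real.exp 1 * (t + 1) * (((t : ℝ) / d) ^ k * Real.exp (-(7 / 32) * t)) := by
        gcongr
        refine (prod_heatKernel_le hu0 (h1.trans ?_) hxy).trans (by gcongr)
        rw [Real.exp_le_one_iff]
        linarith
    _ = _ := by rw [div_pow]; ring

end SmallTimes

/-! ### Times after `d`, and summation to the Green's function. -/

section Green

variable {n : ℕ} [NeZero n] {d : ℕ}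

theorem pow_transition_torus_le_of_ge (hn : 2 ≤ n) (hd : 8 ≤ d) {t : ℕ} (ht : d ≤ t)
    (x y : Fin d → ZMod n) :
    (transition (torus n d) ^ t) x y ≤
      8 ^ 8 * (3 / 4) ^ d * (d ^ 2 * ((t : ℝ) ^ 2)⁻¹ + (n : ℝ)⁻¹ ^ 8) := by
  have hd' : (0 : ℝ) < d := by exact_mod_cast (by omega : 0 < d)
  have hu1 : 1 ≤ (t : ℝ) / d := (one_le_div hd').2 (by exact_mod_cast ht)
  have h1 : heatReturn n ((t : ℝ) / d) ≤ 3 / 4 :=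
    ((heatReturn_antitone hu1).trans (heatReturn_le_one_sub hn zero_le_one le_rfl)).trans_eq
      (by norm_num)
  have h0 := heatReturn_nonneg (n := n) ((t : ℝ) / d)
  obtain ⟨e, rfl⟩ := Nat.exists_eq_add_of_le' hd
  refine (pow_transition_torus_le hn (by omega) t x y).trans ?_
  rw [pow_add]
  -- Eight factors supply the decay in `t`, the other `d - 8` supply `(3 / 4) ^ (d - 8)`; the
  -- constant is `6 ^ 8 (4 / 3) ^ 8 = 8 ^ 8`.
  refine (mul_le_mul (pow_le_pow_left₀ h0 h1 e) (heatReturn_pow_eight_le hu1)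
    (by positivity) (by positivity)).trans_eq ?_
  rw [inv_div, div_pow ((e + 8 : ℕ) : ℝ), pow_add _ e 8]
  ring

theorem sum_pow_transition_torus_le_of_gt (hn : 2 ≤ n) (hd : 8 ≤ d) (x y : Fin d → ZMod n) :
    ∑ t ∈ Ioc d (3 * n ^ 3 * d ^ 2), (transition (torus n d) ^ t) x y ≤
      4 * 8 ^ 8 * (d ^ 2 * (3 / 4) ^ d) := by
  set T := 3 * n ^ 3 * d ^ 2 with hT
  have hn1 : (1 : ℝ) ≤ n := by exact_mod_cast (by omega : 1 ≤ n)
  have hd1 : (1 : ℝ) ≤ d := by exact_mod_cast (by omega : 1 ≤ d)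
  have hdT : d ≤ T := by
    rw [hT, sq, ← mul_assoc]
    exact Nat.le_mul_of_pos_left _ (by positivity)
  have h1 : ∑ t ∈ Ioc d T, ((t : ℝ) ^ 2)⁻¹ ≤ 1 :=
    (sum_Ioc_inv_sq_le_sub (by omega) hdT).trans
      ((sub_le_self _ (by positivity)).trans (inv_le_one_of_one_le₀ hd1))
  have h2 : ((T - d : ℕ) : ℝ) * (n : ℝ)⁻¹ ^ 8 ≤ 3 * d ^ 2 := by
    calc ((T - d : ℕ) : ℝ) * (n : ℝ)⁻¹ ^ 8 ≤ (T : ℝ) * (n : ℝ)⁻¹ ^ 8 := by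
          gcongr
          exact Nat.sub_le _ _
      _ = 3 * d ^ 2 * ((n : ℝ)⁻¹ ^ 5) := by
          rw [hT]
          push_cast
          field_simp
      _ ≤ _ := mul_le_of_le_one_right (by positivity)
          (pow_le_one₀ (by positivity) (inv_le_one_of_one_le₀ hn1))
  calc _ ≤ ∑ t ∈ Ioc d T,
        8 ^ 8 * (3 / 4) ^ d * (d ^ 2 * ((t : ℝ) ^ 2)⁻¹ + (n : ℝ)⁻¹ ^ 8) :=
        Finset.sum_le_sum fun t ht => pow_transition_torus_le_of_ge hn hd (mem_Ioc.1 ht).1.le x y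
    _ = 8 ^ 8 * (3 / 4) ^ d * (d ^ 2 * ∑ t ∈ Ioc d T, ((t : ℝ) ^ 2)⁻¹ +
        ((T - d : ℕ) : ℝ) * (n : ℝ)⁻¹ ^ 8) := by
        rw [← Finset.mul_sum, Finset.sum_add_distrib, ← Finset.mul_sum, sum_const, Nat.card_Ioc,
          nsmul_eq_mul]
    _ ≤ 8 ^ 8 * (3 / 4) ^ d * (d ^ 2 * 1 + 3 * d ^ 2) := by gcongr
    _ = _ := by ring

theorem summable_mul_pow_mul_exp (k : ℕ) :
    Summable fun t : ℕ => ((t : ℝ) + 1) * t ^ k * Real.exp (-(7 / 32) * t) := by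
  have h := (Real.summable_pow_mul_exp_neg_nat_mul (k + 1) (r := 7 / 32) (by norm_num)).add
    (Real.summable_pow_mul_exp_neg_nat_mul k (r := 7 / 32) (by norm_num))
  refine h.congr fun t => ?_
  ring

theorem exists_pow_mul_geometric_le (k : ℕ) :
    ∃ M : ℝ, ∀ d : ℕ, (d : ℝ) ^ k * (3 / 4 : ℝ) ^ d ≤ M := by
  obtain ⟨M, hM⟩ := (tendsto_pow_const_mul_const_pow_of_abs_lt_one k
    (r := (3 / 4 : ℝ)) (by rw [abs_of_pos] <;> norm_num)).bddAbove_range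
  exact ⟨M, fun d => hM ⟨d, rfl⟩⟩

theorem green_torus_le (hn : 2 ≤ n) (hd : 8 ≤ d) {k : ℕ} (hk : 8 * k ≤ d)
    {x y : Fin d → ZMod n} (hxy : k ≤ l1dist x y) :
    green (torus n d) x y ≤
      Real.exp 1 * (∑' t : ℕ, ((t : ℝ) + 1) * t ^ k * Real.exp (-(7 / 32) * t)) / (d : ℝ) ^ k +
        4 * 8 ^ 8 * (d ^ 2 * (3 / 4) ^ d) := by
  have hp := fun t => pow_nonneg' (torus n d) t x y
  have hT := tUnif_torus_le hn (by omega : 0 < d)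
  have hsub : range (tUnif (torus n d) + 1) ⊆ range (d + 1) ∪ Ioc d (3 * n ^ 3 * d ^ 2) := by
    intro t ht
    simp only [mem_union, mem_range, mem_Ioc] at ht ⊢
    omega
  have hdisj : Disjoint (range (d + 1)) (Ioc d (3 * n ^ 3 * d ^ 2)) := by
    rw [Finset.disjoint_left]
    intro t ht ht'
    simp only [mem_range, mem_Ioc] at ht ht'
    omega
  unfold green
  refine (Finset.sum_le_sum_of_subset_of_nonneg hsub fun t _ _ => hp t).trans ?_
  rw [Finset.sum_union hdisj]
  refine add_le_add ?_ (sum_pow_transition_torus_le_of_gt hn hd x y)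
  calc _ ≤ ∑ t ∈ range (d + 1),
        Real.exp 1 * (((t : ℝ) + 1) * t ^ k * Real.exp (-(7 / 32) * t)) / (d : ℝ) ^ k :=
        Finset.sum_le_sum fun t ht => pow_transition_torus_le_of_le hn (by omega) hk hxy
          (Nat.lt_succ_iff.1 (mem_range.1 ht))
    _ ≤ _ := by
        rw [← Finset.sum_div, ← Finset.mul_sum]
        gcongr
        exact (summable_mul_pow_mul_exp k).sum_le_tsum _ fun t _ => by positivity

end Green
end LazyWalk

theorem mainTheorem6 :
    ∀ k : ℕ, ∃ C : ℝ, 0 < C ∧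
      ∀ (n d : ℕ) [NeZero n], 2 ≤ n → 8 ≤ d → (k : ℝ) ≤ (d : ℝ) / 8 →
        ∀ x y : Fin d → ZMod n, k ≤ LazyWalk.l1dist x y →
          LazyWalk.green (LazyWalk.torus n d) x y ≤ C / (d : ℝ) ^ k := by
  intro k
  -- The two extra powers absorb the factor `d ^ 2` from the times after `d`.
  obtain ⟨M, hM⟩ := LazyWalk.exists_pow_mul_geometric_le (k + 2)
  set S := ∑' t : ℕ, ((t : ℝ) + 1) * t ^ k * Real.exp (-(7 / 32) * t)
  have hS : 0 ≤ S := tsum_nonneg fun t => by positivity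
  have hM0 : 0 ≤ M := le_trans (by positivity) (hM 0)
  -- The summand `1` serves only to make the constant strictly positive.
  refine ⟨Real.exp 1 * S + 4 * 8 ^ 8 * M + 1, by positivity, ?_⟩
  intro n d _ hn hd hk x y hxy
  have hd0 : (0 : ℝ) < d := by exact_mod_cast (by omega : 0 < d)
  have hk' : 8 * k ≤ d := by
    have : (8 * k : ℝ) ≤ d := by linarith
    exact_mod_cast this
  have h1 : (d : ℝ) ^ 2 * (3 / 4) ^ d ≤ M / (d : ℝ) ^ k := by
    rw [le_div_iff₀ (by positivity)]
    exact le_trans (le_of_eq (by ring)) (hM d)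
  calc _ ≤ _ := LazyWalk.green_torus_le hn hd hk' hxy
    _ ≤ Real.exp 1 * S / (d : ℝ) ^ k + 4 * 8 ^ 8 * (M / (d : ℝ) ^ k) := by gcongr
    _ = (Real.exp 1 * S + 4 * 8 ^ 8 * M) / (d : ℝ) ^ k := by ring
    _ ≤ _ := div_le_div_of_nonneg_right (by linarith) (by positivity)
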